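/- An $((n,K,d))_q$ quantum code is a $K$-dimensional subspace $Q$ of $(\mathbb{C}^q)^{\otimes n}$ that detects every error affecting fewer than $d$ of the $n$ tensor factors but fails to detect some error affecting $d$ tensor factors; here a linear operator $E$ affects only the factors in a set $S$ if it acts as the identity on all factors outside $S$, that is $E=A_S\otimes I$, and $Q$ detects $E$ if $P E P = cP$ for some $c\in\mathbb{C}$, where $P$ is the orthogonal projector onto $Q$. (Since a subspace of dimension at most $1$ detects every operator, and every code detects the scalars, this forces $K\ge 2$ and $d\ge 1$.) Theorem. Let $q\ge 3$ be an integer, let $\delta$ be a real number with $2e\,q^{-2}\le\delta\le 1$, and let $Q$ be an $((n,K,d))_q$ quantum code, degenerate or nondegenerate, with $$\log_q K + d \le (1-\delta)n .$$ Then $Q$ satisfies the quantum Hamming bound $$K \le \frac{q^n}{\sum_{j=0}^{\lfloor (d-1)/2\rfloor}\binom{n}{j}(q^2-1)^j}.$$ -/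

import Mathlib

/-- The state space `(ℂ^q)^{⊗ n}` of `n` quantum systems with `q` levels each, written in its
computational orthonormal basis, which is indexed by the words `x : Fin n → Fin q`. -/
abbrev QState (q n : ℕ) : Type := EuclideanSpace ℂ (Fin n → Fin q)

/-- The matrix of the operator `A ⊗ 1` that applies `A` to the systems in `S` and the identity
to all the other systems. -/
def localMatrix {q n : ℕ} (S : Finset (Fin n)) (A : Matrix (S → Fin q) (S → Fin q) ℂ) :
    Matrix (Fin n → Fin q) (Fin n → Fin q) ℂ :=
  Matrix.of fun x y =>
    if ∀ i, i ∉ S → x i = y i then A (fun i => x i) (fun i => y i) else 0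

/-- The error `E` affects only the systems in `S`. -/
def ActsOn {q n : ℕ} (E : QState q n →L[ℂ] QState q n) (S : Finset (Fin n)) : Prop :=
  ∃ A : Matrix (S → Fin q) (S → Fin q) ℂ, E = Matrix.toEuclideanCLM (𝕜 := ℂ) (localMatrix S A)

/-- The code `Q` detects the error `E`: `P E P = c P` for a scalar `c`, where `P` is the
orthogonal projector onto `Q`. -/
def Detects {q n : ℕ} (Q : Submodule ℂ (QState q n)) (E : QState q n →L[ℂ] QState q n) : Prop :=
  ∃ c : ℂ, Q.starProjection ∘L E ∘L Q.starProjection = c • Q.starProjection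

/-- `Q` is an `((n, K, d))_q` quantum code: a `K`-dimensional subspace of `(ℂ^q)^{⊗ n}` that
detects all errors affecting less than `d` systems, but cannot detect some error affecting
`d` systems. -/
structure IsQuantumCode {q n : ℕ} (Q : Submodule ℂ (QState q n)) (K d : ℕ) : Prop where
  finrank_eq : Module.finrank ℂ Q = K
  detects : ∀ (S : Finset (Fin n)) (E : QState q n →L[ℂ] QState q n),
    S.card < d → ActsOn E S → Detects Q E
  not_detects : ∃ (S : Finset (Fin n)) (E : QState q n →L[ℂ] QState q n),
    S.card = d ∧ ActsOn E S ∧ ¬ Detects Q E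

/-!
Why the bound holds. Let `t = ⌊(d - 1) / 2⌋`. The Hamming sum is at most `q ^ (2 t) (e n / t) ^ t`
(`hamming_sum_le_of_le`), and there are two regimes, separated by `t = e n / q²`.

* If `t ≥ e n / q²`, then `(e n / t) ^ t ≤ q ^ (2 t)`, so the Hamming sum is at most `q ^ (4 t)`,
  which is at most `q ^ (2 (d - 1))`, and the quantum Singleton bound `K q ^ (2 (d - 1)) ≤ q ^ n`
  suffices.
* If `t ≤ e n / q²`, then `(e n / t) ^ t ≤ q ^ (2 e n / q²) ≤ q ^ (δ n)`, because `(e n / t) ^ t`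
  increases with `t` up to `t = n`. So the Hamming sum is at most `q ^ (d + δ n)`, and the
  hypothesis `K ≤ q ^ ((1 - δ) n - d)` suffices.

The quantum Singleton bound also has to cover degenerate codes. Split the `n` systems into `A`, `B`
and `C`, with `A` and `B` so small that all errors on `A` and all errors on `B` are detected. An
orthonormal basis of the code is a tensor with legs `R, A, B, C`, where `R` has dimension `K`, and
detection says that the marginals of this tensor on `RA` and `RB` are `1 ⊗ σ` and `1 ⊗ τ`.
Comparing ranks across the cut `RA | BC` gives `K rank σ ≤ rank τ · dim C`, and symmetrically
`K rank τ ≤ rank σ · dim C`; hence `K ≤ dim C` (`card_le_of_uncorrelated_marginals`). This is the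
entropic proof of the Singleton bound with ranks in place of entropies.
-/

/-! ### Rank factorizations -/

/-- A matrix `M` over a field factors as `X * Y` through its rank, with `X` having a left inverse
and `Y` a right inverse. -/
theorem exists_rank_factorization {m n : Type*} [Fintype m] [Fintype n] [DecidableEq m]
    [DecidableEq n] {𝕜 : Type*} [Field 𝕜] (M : Matrix m n 𝕜) :
    ∃ (X : Matrix m (Fin M.rank) 𝕜) (Y : Matrix (Fin M.rank) n 𝕜)
      (X' : Matrix (Fin M.rank) m 𝕜) (Y' : Matrix n (Fin M.rank) 𝕜),
      M = X * Y ∧ X' * X = 1 ∧ Y * Y' = 1 := by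
  let f := M.mulVecLin
  have hr : Module.finrank 𝕜 (LinearMap.range f) = M.rank := rfl
  let e : LinearMap.range f ≃ₗ[𝕜] (Fin M.rank → 𝕜) :=
    LinearEquiv.ofFinrankEq _ _ (by simp [hr])
  let F : (Fin M.rank → 𝕜) →ₗ[𝕜] (m → 𝕜) := (LinearMap.range f).subtype ∘ₗ e.symm.toLinearMap
  let G : (n → 𝕜) →ₗ[𝕜] (Fin M.rank → 𝕜) := e.toLinearMap ∘ₗ f.rangeRestrict
  obtain ⟨F', hF'⟩ := LinearMap.exists_leftInverse_of_injective F <| by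
    rw [LinearMap.ker_eq_bot]
    exact Subtype.val_injective.comp e.symm.injective
  obtain ⟨G', hG'⟩ := LinearMap.exists_rightInverse_of_surjective G <| by
    rw [LinearMap.range_eq_top]
    exact e.surjective.comp f.surjective_rangeRestrict
  refine ⟨F.toMatrix', G.toMatrix', F'.toMatrix', G'.toMatrix', ?_, ?_, ?_⟩
  · rw [← LinearMap.toMatrix'_comp]
    have : F ∘ₗ G = f := LinearMap.ext fun x => by simp [F, G]
    rw [this]
    exact (LinearMap.toMatrix'_toLin' M).symm
  · rw [← LinearMap.toMatrix'_comp, hF', LinearMap.toMatrix'_id]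
  · rw [← LinearMap.toMatrix'_comp, hG', LinearMap.toMatrix'_id]

open Kronecker in
theorem card_mul_rank_le_rank_one_kronecker {m R : Type*} [Fintype m] [Fintype R] [DecidableEq m]
    [DecidableEq R] {𝕜 : Type*} [Field 𝕜] (M : Matrix m m 𝕜) :
    Fintype.card R * M.rank ≤ ((1 : Matrix R R 𝕜) ⊗ₖ M).rank := by
  obtain ⟨X, Y, X', Y', hM, hX, hY⟩ := exists_rank_factorization M
  have key : ((1 : Matrix R R 𝕜) ⊗ₖ X') * (((1 : Matrix R R 𝕜) ⊗ₖ M) * ((1 : Matrix R R 𝕜) ⊗ₖ Y'))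
      = 1 := by
    rw [← Matrix.mul_kronecker_mul, ← Matrix.mul_kronecker_mul]
    have : X' * (M * Y') = 1 := by
      calc X' * (M * Y') = X' * ((X * Y) * Y') := by congr 2
        _ = 1 := by rw [Matrix.mul_assoc X, hY, Matrix.mul_one, hX]
    rw [this]
    simp
  calc Fintype.card R * M.rank = (1 : Matrix (R × Fin M.rank) (R × Fin M.rank) 𝕜).rank := by
        simp [Matrix.rank_one]
    _ ≤ _ := by
        rw [← key]
        exact (Matrix.rank_mul_le_right _ _).trans (Matrix.rank_mul_le_left _ _)

/-! ### Tensors with uncorrelated marginals -/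

open Kronecker Matrix ComplexOrder in
/-- A tensor `u` with legs `R, A, B, C` whose marginals on `RA` and `RB` are `1 ⊗ σ` and `1 ⊗ τ`.
The left side is the rank of `u` across the cut `RA | BC`; the right side bounds it by the rank of
`u` across `B | RAC` times the dimension of `C`. -/
theorem card_mul_rank_marginal_le {R A B C : Type*} [Fintype R] [Fintype A] [Fintype B] [Fintype C]
    [DecidableEq R] [DecidableEq A] [DecidableEq B] [DecidableEq C] [Nonempty R]
    (u : R → A → B → C → ℂ) (σ : Matrix A A ℂ) (τ : Matrix B B ℂ)
    (hσ : ∀ i j a a', ∑ p : B × C, u i a p.1 p.2 * star (u j a' p.1 p.2)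
      = if i = j then σ a a' else 0)
    (hτ : ∀ i j b b', ∑ p : A × C, u i p.1 b p.2 * star (u j p.1 b' p.2)
      = if i = j then τ b b' else 0) :
    Fintype.card R * σ.rank ≤ τ.rank * Fintype.card C := by
  let W : Matrix (R × A) (B × C) ℂ := of fun p s => u p.1 p.2 s.1 s.2
  let V : Matrix B (R × (A × C)) ℂ := of fun b s => u s.1 s.2.1 b s.2.2
  have hW : W * Wᴴ = (1 : Matrix R R ℂ) ⊗ₖ σ := by
    ext ⟨i, a⟩ ⟨j, a'⟩
    simp only [mul_apply, conjTranspose_apply, W, of_apply, hσ, kroneckerMap_apply, one_apply,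
      ite_mul, one_mul, zero_mul]
  have hV : V * Vᴴ = (Fintype.card R : ℂ) • τ := by
    ext b b'
    simp only [mul_apply, conjTranspose_apply, V, of_apply]
    rw [Fintype.sum_prod_type]
    simp only [hτ]
    simp
  have hVτ : V.rank = τ.rank := by
    rw [← rank_self_mul_conjTranspose, hV]
    exact rank_smul_of_mem_nonZeroDivisors _ (by simp)
  -- Factoring the leg `B` through a space of dimension `rank τ` factors `W` through that space
  -- tensored with `C`.
  obtain ⟨X, Y, -, -, hXY, -, -⟩ := exists_rank_factorization V
  have hfac : W = (of fun p s => Y s.1 (p.1, p.2, s.2) : Matrix (R × A) (Fin V.rank × C) ℂ) *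
      (Xᵀ ⊗ₖ (1 : Matrix C C ℂ)) := by
    ext ⟨i, a⟩ ⟨b, c⟩
    have h : u i a b c = (X * Y) b (i, a, c) := by rw [← hXY]; rfl
    simp [W, h, mul_apply, Fintype.sum_prod_type, one_apply, mul_comm]
  calc Fintype.card R * σ.rank ≤ W.rank := by
        rw [← rank_self_mul_conjTranspose W, hW]
        exact card_mul_rank_le_rank_one_kronecker σ
    _ ≤ τ.rank * Fintype.card C := by
        rw [hfac, ← hVτ]
        refine (rank_mul_le_left _ _).trans ((rank_le_card_width _).trans ?_)
        simp

/-- A nonzero tensor with legs `R, A, B, C` in which `R` is maximally mixed and uncorrelated with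
`A`, and likewise with `B`, satisfies `dim R ≤ dim C`. -/
theorem card_le_of_uncorrelated_marginals {R A B C : Type*} [Fintype R] [Fintype A] [Fintype B]
    [Fintype C] [DecidableEq R] [DecidableEq A] [DecidableEq B] [DecidableEq C] [Nonempty R]
    (u : R → A → B → C → ℂ) (hu : u ≠ 0) (σ : Matrix A A ℂ) (τ : Matrix B B ℂ)
    (hσ : ∀ i j a a', ∑ p : B × C, u i a p.1 p.2 * star (u j a' p.1 p.2)
      = if i = j then σ a a' else 0)
    (hτ : ∀ i j b b', ∑ p : A × C, u i p.1 b p.2 * star (u j p.1 b' p.2)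
      = if i = j then τ b b' else 0) :
    Fintype.card R ≤ Fintype.card C := by
  have h1 := card_mul_rank_marginal_le u σ τ hσ hτ
  have h2 := card_mul_rank_marginal_le (fun i b a c => u i a b c) τ σ hτ hσ
  have hσ0 : 0 < σ.rank := by
    rw [Nat.pos_iff_ne_zero]
    intro h0
    have hz : σ = 0 := by
      obtain ⟨X, Y, -, -, hXY, -, -⟩ := exists_rank_factorization σ
      ext a a'
      have : IsEmpty (Fin σ.rank) := by rw [h0]; infer_instance
      rw [congrFun₂ hXY a a', Matrix.mul_apply, Finset.univ_eq_empty, Finset.sum_empty,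
        Matrix.zero_apply]
    apply hu
    funext i a b c
    have h := hσ i i a a
    simp only [hz, Matrix.zero_apply, ite_self, RCLike.star_def, RCLike.mul_conj] at h
    have := (Finset.sum_eq_zero_iff_of_nonneg
      (f := fun p : B × C => ‖u i a p.1 p.2‖ ^ 2) (fun _ _ => by positivity)).1
      (by apply Complex.ofReal_injective; simpa using h) (b, c) (Finset.mem_univ _)
    simpa using this
  have hR : 0 < Fintype.card R := Fintype.card_pos
  have hτ0 : 0 < τ.rank := by
    by_contra h
    have : τ.rank = 0 := by omega
    rw [this, zero_mul] at h1
    have := Nat.mul_pos hR hσ0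
    omega
  by_contra! hlt
  have h3 : Fintype.card C * σ.rank < Fintype.card R * σ.rank := Nat.mul_lt_mul_of_pos_right hlt hσ0
  have h4 : Fintype.card C * τ.rank < Fintype.card R * τ.rank := Nat.mul_lt_mul_of_pos_right hlt hτ0
  have h5 : Fintype.card C * σ.rank < Fintype.card C * τ.rank := by linarith
  have h6 : Fintype.card C * τ.rank < Fintype.card C * σ.rank := by linarith
  exact lt_asymm h5 h6

/-! ### Detection of local errors -/

/-- For disjoint sets `A` and `B` of systems, the words on all systems are the triples of words on
`A`, on `B`, and on the remaining systems. -/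
def glueEquiv {n q : ℕ} {A B : Finset (Fin n)} (hAB : Disjoint A B) :
    (A → Fin q) × (B → Fin q) × ({i // i ∉ A ∪ B} → Fin q) ≃ (Fin n → Fin q) where
  toFun p i := if hA : i ∈ A then p.1 ⟨i, hA⟩ else if hB : i ∈ B then p.2.1 ⟨i, hB⟩
    else p.2.2 ⟨i, by simp [hA, hB]⟩
  invFun x := (fun i => x i, fun i => x i, fun i => x i)
  left_inv := by
    rintro ⟨a, b, c⟩
    refine Prod.ext ?_ (Prod.ext ?_ ?_) <;> funext ⟨i, hi⟩
    · simp [hi]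
    · simp [hi, Finset.disjoint_right.1 hAB hi]
    · simp only [Finset.mem_union, not_or] at hi
      simp [hi]
  right_inv x := by
    funext i
    by_cases hA : i ∈ A <;> by_cases hB : i ∈ B <;> simp [hA, hB]

theorem glueEquiv_eqOn_compl_left {n q : ℕ} {A B : Finset (Fin n)} (hAB : Disjoint A B)
    (a a' : A → Fin q) (b b' : B → Fin q) (c c' : {i // i ∉ A ∪ B} → Fin q) :
    (∀ i, i ∉ A → glueEquiv hAB (a, b, c) i = glueEquiv hAB (a', b', c') i)
      ↔ (b, c) = (b', c') := by
  refine ⟨fun h => Prod.ext (funext fun i => ?_) (funext fun i => ?_), fun h i hi => ?_⟩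
  · have hi := Finset.disjoint_right.1 hAB i.2
    simpa [glueEquiv, hi] using h i hi
  · obtain ⟨hiA, hiB⟩ := not_or.1 (mt Finset.mem_union.2 i.2)
    simpa [glueEquiv, hiA, hiB] using h i hiA
  · obtain ⟨rfl, rfl⟩ := Prod.ext_iff.1 h
    simp [glueEquiv, hi]

theorem glueEquiv_eqOn_compl_right {n q : ℕ} {A B : Finset (Fin n)} (hAB : Disjoint A B)
    (a a' : A → Fin q) (b b' : B → Fin q) (c c' : {i // i ∉ A ∪ B} → Fin q) :
    (∀ i, i ∉ B → glueEquiv hAB (a, b, c) i = glueEquiv hAB (a', b', c') i)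
      ↔ (a, c) = (a', c') := by
  refine ⟨fun h => Prod.ext (funext fun i => ?_) (funext fun i => ?_), fun h i hi => ?_⟩
  · have hi := Finset.disjoint_left.1 hAB i.2
    simpa [glueEquiv, hi] using h i hi
  · obtain ⟨hiA, hiB⟩ := not_or.1 (mt Finset.mem_union.2 i.2)
    simpa [glueEquiv, hiA, hiB] using h i hiB
  · obtain ⟨rfl, rfl⟩ := Prod.ext_iff.1 h
    simp [glueEquiv, hi]

/-- Matrix elements of the matrix unit `|a⟩⟨a'|` on `S`, for any splitting `e` of the words into a
part on `S` and a rest `β`. -/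
theorem inner_localMatrix_single {n q : ℕ} {S : Finset (Fin n)} {β : Type*} [Fintype β]
    (e : (S → Fin q) × β ≃ (Fin n → Fin q))
    (he : ∀ a b (i : S), e (a, b) i = a i)
    (he' : ∀ a a' b b', (∀ i, i ∉ S → e (a, b) i = e (a', b') i) ↔ b = b')
    (a a' : S → Fin q) (v w : QState q n) :
    inner ℂ v (Matrix.toEuclideanCLM (𝕜 := ℂ) (localMatrix S (Matrix.single a a' 1)) w)
      = ∑ b, star (v (e (a, b))) * w (e (a', b)) := by
  classical
  have hM : ∀ p p', localMatrix S (Matrix.single a a' (1 : ℂ)) (e p) (e p')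
      = if p'.2 = p.2 then if p.1 = a then if p'.1 = a' then 1 else 0 else 0 else 0 := by
    rintro ⟨x, y⟩ ⟨x', y'⟩
    simp only [localMatrix, Matrix.of_apply, he, he', Matrix.single_apply]
    grind
  rw [PiLp.inner_apply, ← e.sum_comp]
  simp only [Matrix.ofLp_toEuclideanCLM, Matrix.mulVec, dotProduct, RCLike.inner_apply]
  simp_rw [← e.sum_comp, hM]
  simp [Fintype.sum_prod_type, mul_comm]

theorem inner_of_detects {q n : ℕ} {Q : Submodule ℂ (QState q n)}
    {E : QState q n →L[ℂ] QState q n} (h : Detects Q E) :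
    ∃ c : ℂ, ∀ v ∈ Q, ∀ w ∈ Q, inner ℂ v (E w) = c * inner ℂ v w := by
  obtain ⟨c, hc⟩ := h
  refine ⟨c, fun v hv w hw => ?_⟩
  have h1 := congrArg (inner ℂ v) (DFunLike.congr_fun hc w)
  simp only [ContinuousLinearMap.comp_apply, smul_apply,
    Submodule.starProjection_eq_self_iff.2 hw, inner_smul_right] at h1
  rwa [← Submodule.inner_starProjection_left_eq_right,
    Submodule.starProjection_eq_self_iff.2 hv] at h1

/-- A code of dimension at most one detects every error, so having an undetected error forces
`K ≥ 2`. -/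
theorem detects_of_finrank_le_one {q n : ℕ} {Q : Submodule ℂ (QState q n)}
    (hQ : Module.finrank ℂ Q ≤ 1) (E : QState q n →L[ℂ] QState q n) : Detects Q E := by
  obtain ⟨v, hv⟩ := finrank_le_one_iff.1 hQ
  obtain ⟨c, hc⟩ := hv (Q.orthogonalProjectionOnto (E v))
  refine ⟨c, ?_⟩
  ext1 x
  obtain ⟨y, hy⟩ := hv (Q.orthogonalProjectionOnto x)
  have hPx : Q.starProjection x = y • (v : QState q n) := by
    rw [Submodule.starProjection_apply, ← hy]; rfl
  have hPE : Q.starProjection (E v) = c • (v : QState q n) := by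
    rw [Submodule.starProjection_apply, ← hc]; rfl
  simp only [ContinuousLinearMap.comp_apply, smul_apply, hPx, map_smul, hPE]
  rw [smul_comm]

/-! ### The quantum Singleton bound -/

/-- If all errors on `A` and all errors on `B` are detected, then the code has dimension at most
that of the systems outside `A ∪ B`. -/
theorem finrank_le_pow_of_detects_disjoint {q n : ℕ} {Q : Submodule ℂ (QState q n)}
    {A B : Finset (Fin n)} (hAB : Disjoint A B)
    (hA : ∀ E, ActsOn E A → Detects Q E) (hB : ∀ E, ActsOn E B → Detects Q E) :
    Module.finrank ℂ Q ≤ q ^ (n - (A.card + B.card)) := by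
  classical
  rcases Nat.eq_zero_or_pos (Module.finrank ℂ Q) with h0 | hpos
  · simp [h0]
  let v := stdOrthonormalBasis ℂ Q
  have hv : ∀ i j, inner ℂ (v i : QState q n) (v j : QState q n) = if i = j then 1 else 0 :=
    fun i j => by
      rw [← Submodule.coe_inner]; exact orthonormal_iff_ite.1 v.orthonormal i j
  have hσ : ∀ a a' : A → Fin q, ∃ c : ℂ, ∀ v ∈ Q, ∀ w ∈ Q, inner ℂ v
      (Matrix.toEuclideanCLM (𝕜 := ℂ) (localMatrix A (Matrix.single a a' 1)) w)
        = c * inner ℂ v w := fun a a' => inner_of_detects (hA _ ⟨_, rfl⟩)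
  have hτ : ∀ b b' : B → Fin q, ∃ c : ℂ, ∀ v ∈ Q, ∀ w ∈ Q, inner ℂ v
      (Matrix.toEuclideanCLM (𝕜 := ℂ) (localMatrix B (Matrix.single b b' 1)) w)
        = c * inner ℂ v w := fun b b' => inner_of_detects (hB _ ⟨_, rfl⟩)
  choose σ hσ using hσ
  choose τ hτ using hτ
  let e := glueEquiv (q := q) hAB
  let e' : (B → Fin q) × (A → Fin q) × ({i // i ∉ A ∪ B} → Fin q) ≃ (Fin n → Fin q) :=
    { toFun := fun p => e (p.2.1, p.1, p.2.2)
      invFun := fun x => ((e.symm x).2.1, (e.symm x).1, (e.symm x).2.2)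
      left_inv := fun p => by simp
      right_inv := fun x => by simp }
  have : Nonempty (Fin (Module.finrank ℂ Q)) := ⟨⟨0, hpos⟩⟩
  have key := card_le_of_uncorrelated_marginals
    -- Conjugating the basis vectors matches the inner product, conjugate-linear on the left.
    (fun i a b c => star ((v i : QState q n) (e (a, b, c)))) ?_ (Matrix.of σ) (Matrix.of τ) ?_ ?_
  · have hcard : Fintype.card {i // i ∉ A ∪ B} = n - (A.card + B.card) := by
      rw [Fintype.card_subtype_compl, Fintype.card_coe, Fintype.card_fin,
        Finset.card_union_of_disjoint hAB]
    rwa [Fintype.card_fin, Fintype.card_fun, hcard, Fintype.card_fin] at key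
  · intro h
    let i : Fin (Module.finrank ℂ Q) := ⟨0, hpos⟩
    have : (v i : QState q n) = 0 := by
      ext x
      have := congrFun (congrFun (congrFun (congrFun h i) (e.symm x).1) (e.symm x).2.1)
        (e.symm x).2.2
      simpa using this
    have h1 := hv i i
    simp [this] at h1
  · intro i j a a'
    have h := hσ a a' _ (v i).2 _ (v j).2
    rw [inner_localMatrix_single e ?_ ?_, hv] at h
    · simpa using h
    · intro a b i
      simp [e, glueEquiv]
    · rintro a a' ⟨b, c⟩ ⟨b', c'⟩
      exact glueEquiv_eqOn_compl_left hAB ..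
  · intro i j b b'
    have h := hτ b b' _ (v i).2 _ (v j).2
    rw [inner_localMatrix_single e' ?_ ?_, hv] at h
    · simpa [e'] using h
    · intro a b i
      simp [e', e, glueEquiv, Finset.disjoint_right.1 hAB i.2]
    · rintro b b' ⟨a, c⟩ ⟨a', c'⟩
      exact glueEquiv_eqOn_compl_right hAB ..

/-- The quantum Singleton bound, for degenerate and nondegenerate codes alike. A one-dimensional code
detects every error and so violates the bound for large `d`; hence the assumption on the
dimension. -/
theorem finrank_mul_pow_le_of_two_le_finrank {q n d : ℕ} {Q : Submodule ℂ (QState q n)}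
    (hd : 1 ≤ d) (hdn : d ≤ n) (hK : 2 ≤ Module.finrank ℂ Q)
    (hdet : ∀ (S : Finset (Fin n)) E, S.card < d → ActsOn E S → Detects Q E) :
    Module.finrank ℂ Q * q ^ (2 * (d - 1)) ≤ q ^ n := by
  obtain ⟨A, -, hAcard⟩ := Finset.exists_subset_card_eq
    (s := (Finset.univ : Finset (Fin n))) (n := d - 1) (by simp; omega)
  have hAc : Aᶜ.card = n - (d - 1) := by rw [Finset.card_compl, hAcard, Fintype.card_fin]
  rcases le_or_gt (2 * (d - 1)) n with hle | hgt
  · obtain ⟨B, hBA, hBcard⟩ := Finset.exists_subset_card_eq (s := Aᶜ) (n := d - 1) (by omega)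
    have hAB : Disjoint A B := (Finset.disjoint_of_subset_left hBA disjoint_compl_left).symm
    have h := finrank_le_pow_of_detects_disjoint hAB (fun E => hdet A E (by omega))
      (fun E => hdet B E (by omega))
    rw [hAcard, hBcard, ← two_mul] at h
    calc _ ≤ q ^ (n - 2 * (d - 1)) * q ^ (2 * (d - 1)) := Nat.mul_le_mul_right _ h
      _ = q ^ n := by rw [← pow_add, Nat.sub_add_cancel hle]
  -- If `2 (d - 1) > n`, then `A` and its complement are both small, so the dimension is at most `1`.
  · have h := finrank_le_pow_of_detects_disjoint (disjoint_compl_right (a := A))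
      (fun E => hdet A E (by omega)) (fun E => hdet Aᶜ E (by omega))
    rw [hAcard, hAc, show n - (d - 1 + (n - (d - 1))) = 0 by omega, pow_zero] at h
    omega

/-! ### Estimates of the Hamming sum -/

open Finset Real in
/-- The Chernoff-type estimate of the Hamming sum: multiply by `s ^ t` with `s = t / n`, and compare
with the binomial expansion of `(1 + s) ^ n ≤ exp t`. -/
theorem hamming_sum_le_of_le {n t q : ℕ} (hq : 1 ≤ q) (ht : 1 ≤ t) (htn : t ≤ n) :
    ∑ j ∈ range (t + 1), (n.choose j : ℝ) * ((q : ℝ) ^ 2 - 1) ^ j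
      ≤ (q : ℝ) ^ (2 * t) * (exp 1 * n / t) ^ t := by
  have hq' : (1 : ℝ) ≤ q := by exact_mod_cast hq
  have ht' : (0 : ℝ) < t := by exact_mod_cast ht
  have hn' : (0 : ℝ) < n := by exact_mod_cast (ht.trans htn)
  set s : ℝ := t / n with hs
  have hs0 : 0 < s := by positivity
  have hs1 : s ≤ 1 := by rw [hs, div_le_one hn']; exact_mod_cast htn
  have hterm : ∀ j ∈ range (t + 1), s ^ t * ((n.choose j : ℝ) * ((q : ℝ) ^ 2 - 1) ^ j)
      ≤ (q : ℝ) ^ (2 * t) * (s ^ j * 1 ^ (n - j) * n.choose j) := by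
    intro j hj
    have hj' : j ≤ t := by simpa [Nat.lt_succ_iff] using hj
    have h1 : s ^ t ≤ s ^ j := pow_le_pow_of_le_one hs0.le hs1 hj'
    have h2 : ((q : ℝ) ^ 2 - 1) ^ j ≤ (q : ℝ) ^ (2 * t) := by
      rw [pow_mul]
      calc ((q : ℝ) ^ 2 - 1) ^ j ≤ ((q : ℝ) ^ 2) ^ j := by
            apply pow_le_pow_left₀ <;> nlinarith
        _ ≤ _ := pow_le_pow_right₀ (one_le_pow₀ hq') hj'
    have h3 : (0 : ℝ) ≤ ((q : ℝ) ^ 2 - 1) ^ j := pow_nonneg (by nlinarith) _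
    calc s ^ t * ((n.choose j : ℝ) * ((q : ℝ) ^ 2 - 1) ^ j)
        ≤ s ^ j * ((n.choose j : ℝ) * (q : ℝ) ^ (2 * t)) := by gcongr
      _ = _ := by ring
  have hsum : s ^ t * ∑ j ∈ range (t + 1), (n.choose j : ℝ) * ((q : ℝ) ^ 2 - 1) ^ j
      ≤ (q : ℝ) ^ (2 * t) * exp 1 ^ t := by
    calc _ ≤ ∑ j ∈ range (t + 1), (q : ℝ) ^ (2 * t) * (s ^ j * 1 ^ (n - j) * n.choose j) := by
          rw [mul_sum]; exact sum_le_sum hterm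
      _ ≤ ∑ j ∈ range (n + 1), (q : ℝ) ^ (2 * t) * (s ^ j * 1 ^ (n - j) * n.choose j) := by
          apply sum_le_sum_of_subset_of_nonneg
          · exact range_mono (by omega)
          · intros; positivity
      _ = (q : ℝ) ^ (2 * t) * (s + 1) ^ n := by rw [← mul_sum, ← add_pow]
      _ ≤ (q : ℝ) ^ (2 * t) * exp s ^ n := by
          gcongr; exact add_one_le_exp s
      _ = _ := by
          rw [← exp_nat_mul, ← exp_nat_mul, hs]
          congr 2
          field_simp
  have : exp 1 * n / t = exp 1 / s := by rw [hs]; field_simp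
  rw [this, div_pow, ← mul_div_assoc, le_div_iff₀ (by positivity), mul_comm]
  exact hsum

open Real in
/-- Below `T = e n / q²` the value of `(e n / t) ^ t` is at most its value at `t = T`. -/
theorem exp_mul_div_pow_le {n t q : ℕ} (hq : 2 ≤ q) (ht : 1 ≤ t)
    (h : (t : ℝ) * (q : ℝ) ^ 2 ≤ exp 1 * n) :
    (exp 1 * n / t) ^ t ≤ (q : ℝ) ^ (2 * exp 1 / (q : ℝ) ^ 2 * n) := by
  have hq' : (2 : ℝ) ≤ q := by exact_mod_cast hq
  have ht' : (0 : ℝ) < t := by exact_mod_cast ht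
  have hq2 : (0 : ℝ) < (q : ℝ) ^ 2 := by positivity
  set T : ℝ := exp 1 * n / (q : ℝ) ^ 2 with hT
  have htT : (t : ℝ) ≤ T := by rw [hT, le_div_iff₀ hq2]; exact h
  have hT0 : 0 < T := ht'.trans_le htT
  have hbase : exp 1 * n / t = (q : ℝ) ^ 2 * (T / t) := by rw [hT]; field_simp
  have hlog : 1 ≤ log ((q : ℝ) ^ 2) := by
    rw [le_log_iff_exp_le hq2]
    have := exp_one_lt_d9
    nlinarith
  have hlog2 : log (T / t) ≤ T / t - 1 := log_le_sub_one_of_pos (by positivity)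
  -- `log (T / t) ≤ T / t - 1` leaves `T - t`, which `(T - t) log (q²)` absorbs since `log (q²) ≥ 1`.
  have hmain : t * log ((q : ℝ) ^ 2 * (T / t)) ≤ T * log ((q : ℝ) ^ 2) := by
    rw [log_mul hq2.ne' (by positivity)]
    have h1 : t * log (T / t) ≤ T - t := by
      calc t * log (T / t) ≤ t * (T / t - 1) := by gcongr
        _ = T - t := by field_simp
    nlinarith
  rw [hbase, rpow_def_of_pos (by positivity),
    ← exp_log (show 0 < (q : ℝ) ^ 2 * (T / t) by positivity), ← exp_nat_mul, exp_le_exp]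
  refine hmain.trans (le_of_eq ?_)
  rw [log_pow, hT]
  push_cast
  ring

/-! ### The quantum Hamming bound -/

theorem theorem1 (q n K d : ℕ) (δ : ℝ) (hq : 3 ≤ q)
    (hδ : 2 * Real.exp 1 / (q : ℝ) ^ 2 ≤ δ) (hδ1 : δ ≤ 1)
    (Q : Submodule ℂ (QState q n)) (hQ : IsQuantumCode Q K d)
    (hKd : Real.logb (q : ℝ) (K : ℝ) + (d : ℝ) ≤ (1 - δ) * (n : ℝ)) :
    (K : ℝ) ≤ (q : ℝ) ^ n /
      ∑ j ∈ Finset.range ((d - 1) / 2 + 1), (n.choose j : ℝ) * ((q : ℝ) ^ 2 - 1) ^ j := by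
  have hq0 : (3 : ℝ) ≤ q := by exact_mod_cast hq
  obtain ⟨S, E, hS, -, hE⟩ := hQ.not_detects
  have hdn : d ≤ n := by rw [← hS]; simpa using S.card_le_univ
  have hK : 2 ≤ K := by
    by_contra! h
    exact hE (detects_of_finrank_le_one (by rw [hQ.finrank_eq]; omega) E)
  have hKpos : (0 : ℝ) < K := by positivity
  set t := (d - 1) / 2 with ht
  have hsum1 : (1 : ℝ) ≤ ∑ j ∈ Finset.range (t + 1), (n.choose j : ℝ) * ((q : ℝ) ^ 2 - 1) ^ j := by
    rw [Finset.sum_range_succ']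
    have : 0 ≤ ∑ j ∈ Finset.range t, (n.choose (j + 1) : ℝ) * ((q : ℝ) ^ 2 - 1) ^ (j + 1) :=
      Finset.sum_nonneg fun j _ => mul_nonneg (by positivity) (pow_nonneg (by nlinarith) _)
    simpa using this
  rw [le_div_iff₀ (by linarith)]
  -- The estimates below divide by `t`; for `t = 0` the bound is `K ≤ q ^ n`.
  rcases Nat.eq_zero_or_pos t with ht0 | htpos
  · have : K ≤ q ^ n := by
      simpa [hQ.finrank_eq] using Submodule.finrank_le Q
    rw [ht0]
    simpa using (by exact_mod_cast this : (K : ℝ) ≤ (q : ℝ) ^ n)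
  have htn : t ≤ n := by omega
  have htR : (0 : ℝ) < t := by exact_mod_cast htpos
  have hball := hamming_sum_le_of_le (q := q) (by omega) htpos htn
  rcases le_total (Real.exp 1 * n) (t * (q : ℝ) ^ 2) with hlarge | hsmall
  -- Large `t`: the Singleton bound.
  · have hsing := finrank_mul_pow_le_of_two_le_finrank (Q := Q) (d := d)
      (by omega) hdn (by rw [hQ.finrank_eq]; exact hK) hQ.detects
    rw [hQ.finrank_eq] at hsing
    have h4t : (q : ℝ) ^ (2 * t) * (Real.exp 1 * n / t) ^ t ≤ (q : ℝ) ^ (2 * (d - 1)) := by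
      calc _ ≤ (q : ℝ) ^ (2 * t) * ((q : ℝ) ^ 2) ^ t := by
            gcongr
            rw [div_le_iff₀ htR]; linarith
        _ = (q : ℝ) ^ (4 * t) := by ring
        _ ≤ _ := pow_le_pow_right₀ (by linarith) (by omega)
    calc _ ≤ (K : ℝ) * (q : ℝ) ^ (2 * (d - 1)) := by gcongr; exact hball.trans h4t
      _ ≤ (q : ℝ) ^ n := by exact_mod_cast hsing
  -- Small `t`: the hypothesis on `K` and `d`.
  · have hsub := exp_mul_div_pow_le (q := q) (by omega) htpos hsmall
    have hKq : (K : ℝ) = (q : ℝ) ^ Real.logb q K :=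
      (Real.rpow_logb (by linarith) (by linarith) hKpos).symm
    have h2t : (q : ℝ) ^ (2 * t) ≤ (q : ℝ) ^ (d : ℝ) := by
      rw [Real.rpow_natCast]
      exact pow_le_pow_right₀ (by linarith) (by omega)
    calc _ ≤ (K : ℝ) * ((q : ℝ) ^ (2 * t) * (Real.exp 1 * n / t) ^ t) := by gcongr
      _ ≤ (q : ℝ) ^ Real.logb q K * ((q : ℝ) ^ (d : ℝ) * (q : ℝ) ^ (δ * n)) := by
          rw [← hKq]
          gcongr
          refine hsub.trans (Real.rpow_le_rpow_of_exponent_le (by linarith) ?_)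
          gcongr
      _ = (q : ℝ) ^ (Real.logb q K + d + δ * n) := by
          rw [Real.rpow_add (by linarith), Real.rpow_add (by linarith), mul_assoc]
      _ ≤ (q : ℝ) ^ (n : ℝ) := Real.rpow_le_rpow_of_exponent_le (by linarith) (by linarith)
      _ = (q : ℝ) ^ n := Real.rpow_natCast _ _
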